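/- Let $N\ge 3$, $r,s\ge1$ be integers, let $p_0,p_1,p_2,p_3\in[0,1]$, and put $q_m:=1-p_m$. Let $\Sigma:=\{0,1\}^N$ (player indices are read cyclically modulo $N$). For $\boldsymbol x\in\Sigma$ put $m_i(\boldsymbol x):=2x_{i-1}+x_{i+1}$, and let $\boldsymbol x^i$ be $\boldsymbol x$ with its $i$th coordinate $x_i$ replaced by $1-x_i$. Put $$c_i(\boldsymbol x):=\begin{cases}p_{m_i(\boldsymbol x)}&\text{if }x_i=0,\\ q_{m_i(\boldsymbol x)}&\text{if }x_i=1.\end{cases}$$ Let $\boldsymbol P_B$ be the stochastic matrix on $\Sigma$ with $P_B(\boldsymbol x,\boldsymbol x^i)=N^{-1}c_i(\boldsymbol x)$ for $i=1,\dots,N$, $P_B(\boldsymbol x,\boldsymbol x)=N^{-1}\sum_{i=1}^N[1-c_i(\boldsymbol x)]$, and all other entries $0$. Let $\boldsymbol P_B^*$ be the stochastic matrix on $\Sigma^*:=\Sigma\times\{1,\dots,N\}$ with $P_B^*((\boldsymbol x,i),(\boldsymbol x^i,j))=N^{-1}c_i(\boldsymbol x)$, $P_B^*((\boldsymbol x,i),(\boldsymbol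 x,j))=N^{-1}[1-c_i(\boldsymbol x)]$ for all $j$, and all other entries $0$. Let $\boldsymbol P_A$, $\boldsymbol P_A^*$ be $\boldsymbol P_B$, $\boldsymbol P_B^*$ with $p_0=p_1=p_2=p_3=1/2$. Let the payoff $w((\boldsymbol x,i),(\boldsymbol y,j))$ be $1$ (a win) if $\boldsymbol y=\boldsymbol x^i$ and $x_i=0$, or $\boldsymbol y=\boldsymbol x$ and $x_i=1$; $-1$ (a loss) if $\boldsymbol y=\boldsymbol x^i$ and $x_i=1$, or $\boldsymbol y=\boldsymbol x$ and $x_i=0$; and $0$ otherwise. Then $\boldsymbol P_A^r\boldsymbol P_B^s$ has a unique stationary distribution $\boldsymbol\pi$, and there is a real number $\mu_{[r,s]}^N$ such that the following holds. Let $\{(\boldsymbol X(n),I(n))\}_{n\ge0}$ be any nonhomogeneous Markov chain in $\Sigma^*$ with one-step transition matrices $\boldsymbol P_A^*,\dots,\boldsymbol P_A^*$ ($r$ times), $\boldsymbol P_B^*,\dots,\boldsymbol P_B^*$ ($s$ times), repeated periodically, and with arbitrary initial distribution. Put $\xi_n:=w((\boldsymbol X(n-1),I(n-1)),(\boldsymbol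 X(n),I(n)))$ and $S_n:=\xi_1+\dots+\xi_n$. Then $n^{-1}S_n\to\mu_{[r,s]}^N$ almost surely as $n\to\infty$. Moreover, writing $[\boldsymbol\nu]_i$ and $[\boldsymbol\nu]_{i,j}$ for the one- and two-dimensional marginals of $\boldsymbol\nu$ at the coordinates $i$ and $i,j$, $$\mu_{[r,s]}^N=\frac1{r+s}\sum_{v=0}^{s-1}\sum_{\boldsymbol x\in\Sigma}[\boldsymbol\pi\boldsymbol P_A^r\boldsymbol P_B^v](\boldsymbol x)\,\frac1N\sum_{i=1}^N[p_{m_i(\boldsymbol x)}-q_{m_i(\boldsymbol x)}],$$ $$\mu_{[r,s]}^N=\frac1{r+s}\sum_{v=0}^{s-1}\sum_{w=0}^1\sum_{z=0}^1[\boldsymbol\pi\boldsymbol P_A^r\boldsymbol P_B^v]_{1,3}(w,z)\,(p_{2w+z}-q_{2w+z}),$$ $$\mu_{[r,s]}^N=\frac1{r+s}\bigg[\sum_{u=0}^{r-1}\{[\boldsymbol\pi\boldsymbol P_A^u]_1(1)-[\boldsymbol\pi\boldsymbol P_A^u]_1(0)\}+\sum_{v=0}^{s-1}\{[\boldsymbol\pi\boldsymbol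 P_A^r\boldsymbol P_B^v]_1(1)-[\boldsymbol\pi\boldsymbol P_A^r\boldsymbol P_B^v]_1(0)\}\bigg],$$ and, if $s=1$, $$\mu_{[r,1]}^N=\frac{N[1-(1-1/N)^{r+1}]}{(r+1)(1-1/N)^r}\{[\boldsymbol\pi\boldsymbol P_A^r]_1(1)-[\boldsymbol\pi\boldsymbol P_A^r]_1(0)\}.$$ -/

import Mathlib

open Matrix MeasureTheory Filter Topology

namespace Parrondo

/-- Statuses (0 = loser, 1 = winner) of `N` players in a circle. The players `1, …, N` are labelled
by residues modulo `N`, so that player `N` is also player `0` and player `N + 1` is player `1`. -/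
abbrev Config (N : ℕ) : Type := ZMod N → Fin 2

/-- The number `2 w + z` in `{0, 1, 2, 3}` with binary digits `w z`. -/
def pairIndex (w z : Fin 2) : Fin 4 := ⟨2 * w.val + z.val, by omega⟩

/-- `m_i(x) = 2 x_{i-1} + x_{i+1}`. -/
def nbrIndex {N : ℕ} (x : Config N) (i : ZMod N) : Fin 4 := pairIndex (x (i - 1)) (x (i + 1))

/-- `x^i`: the configuration `x` with the status of player `i` changed. -/
def flip {N : ℕ} (x : Config N) (i : ZMod N) : Config N := Function.update x i (1 - x i)

/-- The probability that player `i`, if chosen to play, changes status. -/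
noncomputable def flipProb {N : ℕ} (p : Fin 4 → ℝ) (x : Config N) (i : ZMod N) : ℝ :=
  if x i = 0 then p (nbrIndex x i) else 1 - p (nbrIndex x i)

/-- The probability that player `i`, if chosen to play, keeps the same status. -/
noncomputable def stayProb {N : ℕ} (p : Fin 4 → ℝ) (x : Config N) (i : ZMod N) : ℝ :=
  if x i = 0 then 1 - p (nbrIndex x i) else p (nbrIndex x i)

/-- The one-step transition matrix `P_B` on configurations. (The `x^i` are distinct from each other
and from `x`, so at most one term of the last sum is nonzero.) -/
noncomputable def gameB (N : ℕ) [NeZero N] (p : Fin 4 → ℝ) : Matrix (Config N) (Config N) ℝ :=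
  Matrix.of fun x y =>
    if y = x then (N : ℝ)⁻¹ * ∑ i : ZMod N, stayProb p x i
    else ∑ i : ZMod N, if y = flip x i then (N : ℝ)⁻¹ * flipProb p x i else 0

/-- The matrix `P_A`, i.e. `P_B` with all four parameters equal to `1/2`. -/
noncomputable def gameA (N : ℕ) [NeZero N] : Matrix (Config N) (Config N) ℝ :=
  gameB N fun _ => 1 / 2

/-- The augmented state space: `(x, i)` means that the statuses are given by `x` and that `i` is the
next player to play. -/
abbrev AugState (N : ℕ) : Type := Config N × ZMod N

/-- The one-step transition matrix `P_B^*` on the augmented state space. -/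
noncomputable def gameBStar (N : ℕ) [NeZero N] (p : Fin 4 → ℝ) :
    Matrix (AugState N) (AugState N) ℝ :=
  Matrix.of fun a b =>
    if b.1 = flip a.1 a.2 then (N : ℝ)⁻¹ * flipProb p a.1 a.2
    else if b.1 = a.1 then (N : ℝ)⁻¹ * stayProb p a.1 a.2
    else 0

/-- The matrix `P_A^*`, i.e. `P_B^*` with all four parameters equal to `1/2`. -/
noncomputable def gameAStar (N : ℕ) [NeZero N] : Matrix (AugState N) (AugState N) ℝ :=
  gameBStar N fun _ => 1 / 2

/-- The payoff of a transition `(x, i) → (y, j)`: it is `1` (a win) where the entry of `P_B^*` has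
the form `N⁻¹ p_m`, `-1` (a loss) where it has the form `N⁻¹ q_m`, and `0` at impossible
transitions. -/
noncomputable def payoff {N : ℕ} [NeZero N] (a b : AugState N) : ℝ :=
  if b.1 = flip a.1 a.2 then (if a.1 a.2 = 0 then 1 else -1)
  else if b.1 = a.1 then (if a.1 a.2 = 0 then -1 else 1)
  else 0

/-- The transition matrix from time `n` to time `n + 1` for the periodic pattern `A^r B^s`. -/
noncomputable def patternStar (N : ℕ) [NeZero N] (p : Fin 4 → ℝ) (r s n : ℕ) :
    Matrix (AugState N) (AugState N) ℝ :=
  if n % (r + s) < r then gameAStar N else gameBStar N p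

/-- `X` is a (time-inhomogeneous) Markov chain on the probability space `(Ω, ℙ)` with values in the
finite set `S`, whose one-step transition matrix from time `n` to time `n + 1` is `Q n`; the initial
distribution is arbitrary. -/
structure IsMarkovChain {S Ω : Type*} [MeasurableSpace Ω] (Q : ℕ → Matrix S S ℝ)
    (ℙ : Measure Ω) (X : ℕ → Ω → S) : Prop where
  measurable : ∀ (n : ℕ) (a : S), MeasurableSet {ω | X n ω = a}
  step : ∀ (n : ℕ) (a : ℕ → S),
    ℙ.real {ω | ∀ k ≤ n + 1, X k ω = a k} =
      ℙ.real {ω | ∀ k ≤ n, X k ω = a k} * Q n (a n) (a (n + 1))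

/-- The accumulated profit `S_n = ξ_1 + ⋯ + ξ_n`, where `ξ_{k+1}` is the payoff of the transition
from time `k` to time `k + 1`. -/
noncomputable def profit {N : ℕ} [NeZero N] {Ω : Type*} (X : ℕ → Ω → AugState N) (n : ℕ) (ω : Ω) :
    ℝ :=
  ∑ k ∈ Finset.range n, payoff (X k ω) (X (k + 1) ω)

/-- `π` is a stationary distribution (a probability row vector with `π P = π`). -/
def IsStationaryDistribution {S : Type*} [Fintype S] (P : Matrix S S ℝ) (π : S → ℝ) : Prop :=
  π ∈ stdSimplex ℝ S ∧ π ᵥ* P = π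

/-- The one-dimensional marginal `[ν]_i(a)`. -/
noncomputable def marginal₁ {N : ℕ} [NeZero N] (ν : Config N → ℝ) (i : ZMod N) (a : Fin 2) : ℝ :=
  ∑ x : Config N, if x i = a then ν x else 0

/-- The two-dimensional marginal `[ν]_{i,j}(a, b)`. -/
noncomputable def marginal₂ {N : ℕ} [NeZero N] (ν : Config N → ℝ) (i j : ZMod N) (a b : Fin 2) :
    ℝ :=
  ∑ x : Config N, if x i = a ∧ x j = b then ν x else 0

end Parrondo

/-! A play by player `i` sets his status to `1` with probability `p_m` and to `0` otherwise, and its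
payoff is the sign of that new status. Its conditional mean is therefore the drift `p_m - q_m`,
which vanishes in game `A`.

Uniqueness of the stationary distribution needs only that the harmonic functions of `P_A^r P_B^s`
are constant. Let `M` be the oscillation of such a function, attained at a pair of configurations.
Running both with the same player, the bound `M` must be attained again one game earlier. Game `B`
can keep the number of disagreeing coordinates from growing, and game `A` can remove one. After
enough periods the pair coincides, so `M = 0` (`eq_of_pattern_mulVec_eq`).

The same fact makes the Poisson equation for one period solvable. Backward recursion spreads its
solution over the games of the period, and `liftAug` carries it to the augmented chain. The profit
minus `n μ` is then a martingale with bounded increments plus a bounded term, and an `L²` estimate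
along the squares gives the strong law (`IsMarkovChain.ae_tendsto_of_poisson`).

By uniqueness `π` is rotation invariant, so averages over players reduce to a single player. The
total sign of all players changes in one play by (new sign) - (old sign) of the chosen player; over
a period in equilibrium these changes cancel, so total drift equals total mean sign
(`IsStationaryDistribution.sum_meanDrift_eq`). Under `A` the mean sign contracts by `1 - 1/N`, which
yields the closed form for `s = 1`. -/

namespace Parrondo

/-! ### Stationary distributions and the Poisson equation of a finite matrix -/

section Stationary

variable {S : Type*} [Fintype S] [DecidableEq S]

/-- Solvability of the Poisson equation: if the only harmonic functions of a matrix are the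
constants, then every function of mean zero under a stationary distribution is of the form
`φ - Q φ`. -/
theorem IsStationaryDistribution.exists_poisson {Q : Matrix S S ℝ}
    (hQ : ∀ h : S → ℝ, Q *ᵥ h = h → ∀ x y, h x = h y) {π : S → ℝ}
    (hπ : IsStationaryDistribution Q π) {H : S → ℝ} (hH : π ⬝ᵥ H = 0) :
    ∃ φ : S → ℝ, φ = H + Q *ᵥ φ := by
  obtain ⟨⟨hπ0, hπ1⟩, hπQ⟩ := hπ
  have : Nonempty S := by
    by_contra hS
    rw [not_nonempty_iff] at hS
    simp at hπ1
  set L : (S → ℝ) →ₗ[ℝ] (S → ℝ) := Matrix.mulVecLin (1 - Q) with hL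
  have hLa : ∀ φ, L φ = φ - Q *ᵥ φ := fun φ => by simp [hL]
  set ℓ : Module.Dual ℝ (S → ℝ) := dotProductBilin ℝ ℝ π with hℓ
  have hℓa : ∀ φ, ℓ φ = π ⬝ᵥ φ := fun φ => rfl
  have hℓ0 : ℓ ≠ 0 := by
    intro h0
    have := hℓa 1
    rw [h0] at this
    simp [dotProduct, hπ1] at this
  have hker : LinearMap.ker L ≤ Submodule.span ℝ {(1 : S → ℝ)} := by
    intro φ hφ
    rw [LinearMap.mem_ker, hLa, sub_eq_zero] at hφ
    rw [Submodule.mem_span_singleton]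
    refine ⟨φ (Classical.arbitrary S), ?_⟩
    ext x
    simpa using hQ φ hφ.symm _ x
  have h1 : Module.finrank ℝ (LinearMap.ker L) ≤ 1 :=
    (Submodule.finrank_mono hker).trans (finrank_span_singleton (by simp)).le
  have h2 := LinearMap.finrank_range_add_finrank_ker L
  have h3 := Module.Dual.finrank_ker_add_one_of_ne_zero hℓ0
  have hle : LinearMap.range L ≤ LinearMap.ker ℓ := by
    rintro _ ⟨φ, rfl⟩
    rw [LinearMap.mem_ker, hℓa, hLa, dotProduct_sub, dotProduct_mulVec, hπQ, sub_self]
  -- Rank-nullity gives the range codimension at most one, and it lies in the hyperplane `ker ℓ`.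
  have heq : LinearMap.range L = LinearMap.ker ℓ :=
    Submodule.eq_of_le_of_finrank_le hle (by omega)
  have hmem : H ∈ LinearMap.range L := by
    rw [heq, LinearMap.mem_ker, hℓa, hH]
  obtain ⟨φ, hφ⟩ := hmem
  refine ⟨φ, ?_⟩
  rw [← hφ, hLa, sub_add_cancel]

/-- Pairing the Poisson equation for `f - π f` with `π'` cancels `φ` and leaves `π' f = π f`. -/
theorem IsStationaryDistribution.unique {Q : Matrix S S ℝ}
    (hQ : ∀ h : S → ℝ, Q *ᵥ h = h → ∀ x y, h x = h y) {π π' : S → ℝ}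
    (hπ : IsStationaryDistribution Q π) (hπ' : IsStationaryDistribution Q π') : π' = π := by
  have key : ∀ f : S → ℝ, π' ⬝ᵥ f = π ⬝ᵥ f := by
    intro f
    have e1 : π ⬝ᵥ (1 : S → ℝ) = 1 := by simpa [dotProduct] using hπ.1.2
    have e2 : π' ⬝ᵥ (1 : S → ℝ) = 1 := by simpa [dotProduct] using hπ'.1.2
    obtain ⟨φ, hφ⟩ := hπ.exists_poisson hQ (H := f - (π ⬝ᵥ f) • (1 : S → ℝ)) (by
      rw [dotProduct_sub, dotProduct_smul, e1]; simp)
    have := congrArg (fun g => π' ⬝ᵥ g) hφ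
    simp only [dotProduct_add, dotProduct_mulVec, hπ'.2, dotProduct_sub, dotProduct_smul, e2,
      smul_eq_mul, mul_one] at this
    linarith
  ext x
  simpa using key (Pi.single x 1)

/-- `1 - Q` kills the constants, hence is singular and has a left null vector `ν`. Then `|ν| ≤ |ν|
Q` entrywise with equal total mass, so `|ν|` is invariant and can be normalized. -/
theorem exists_isStationaryDistribution [Nonempty S] {Q : Matrix S S ℝ}
    (hQ : Q ∈ rowStochastic ℝ S) : ∃ π, IsStationaryDistribution Q π := by
  obtain ⟨hQ0, hQ1⟩ := mem_rowStochastic.1 hQ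
  obtain ⟨ν, hν0, hν⟩ : ∃ ν : S → ℝ, ν ≠ 0 ∧ ν ᵥ* (1 - Q) = 0 := by
    rw [Matrix.exists_vecMul_eq_zero_iff, ← Matrix.exists_mulVec_eq_zero_iff]
    exact ⟨1, one_ne_zero, by rw [Matrix.sub_mulVec, hQ1, Matrix.one_mulVec, sub_self]⟩
  rw [Matrix.vecMul_sub, Matrix.vecMul_one, sub_eq_zero] at hν
  have hle : ∀ x, |ν x| ≤ ((fun y => |ν y|) ᵥ* Q) x := by
    intro x
    conv_lhs => rw [hν]
    refine (Finset.abs_sum_le_sum_abs _ _).trans (Finset.sum_le_sum fun y _ => ?_)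
    rw [abs_mul, abs_of_nonneg (hQ0 y x)]
  have hsum : ∑ x, |ν x| = ∑ x, ((fun y => |ν y|) ᵥ* Q) x := by
    have := dotProduct_mulVec (fun y => |ν y|) Q 1
    rw [hQ1] at this
    simpa [dotProduct] using this
  have heq : (fun y => |ν y|) ᵥ* Q = fun y => |ν y| := by
    ext x
    exact ((Finset.sum_eq_sum_iff_of_le fun x _ => hle x).1 hsum x (Finset.mem_univ x)).symm
  have hpos : 0 < ∑ x, |ν x| := by
    obtain ⟨x, hx⟩ := Function.ne_iff.1 hν0
    exact Finset.sum_pos' (fun _ _ => abs_nonneg _) ⟨x, Finset.mem_univ x, abs_pos.2 hx⟩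
  refine ⟨(∑ x, |ν x|)⁻¹ • fun y => |ν y|, ⟨fun x => ?_, ?_⟩, ?_⟩
  · simp only [Pi.smul_apply, smul_eq_mul]
    positivity
  · simp only [Pi.smul_apply, smul_eq_mul]
    rw [← Finset.mul_sum, inv_mul_cancel₀ hpos.ne']
  · rw [Matrix.smul_vecMul, heq]

end Stationary

/-! ### One play as an operator on functions -/

section Game

variable {N : ℕ}

theorem flip_ne {x : Config N} {i : ZMod N} : flip x i ≠ x := by
  intro h
  have h1 := congrFun h i
  simp only [flip, Function.update_self] at h1
  generalize x i = a at h1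
  fin_cases a <;> simp at h1

/-- If player `i` plays, then his status becomes `1` with probability `p_m` and `0` with probability
`1 - p_m`. -/
theorem stayProb_mul_add_flipProb_mul (p : Fin 4 → ℝ) (f : Config N → ℝ) (x : Config N)
    (i : ZMod N) :
    stayProb p x i * f x + flipProb p x i * f (flip x i) =
      p (nbrIndex x i) * f (Function.update x i 1) +
        (1 - p (nbrIndex x i)) * f (Function.update x i 0) := by
  obtain h | h : x i = 0 ∨ x i = 1 := by
    generalize x i = a
    fin_cases a <;> simp
  · have h0 : Function.update x i 0 = x := by rw [← h, Function.update_eq_self]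
    simp only [stayProb, flipProb, flip, h, if_true, h0, sub_zero]
    ring
  · have h0 : Function.update x i 1 = x := by rw [← h, Function.update_eq_self]
    simp only [stayProb, flipProb, flip, h, if_neg (one_ne_zero : (1 : Fin 2) ≠ 0), h0, sub_self]

/-- Drawing the two new statuses independently writes the left side as a convex combination of four
increments of `f`. -/
theorem gameB_mulVec_sub_le {p : Fin 4 → ℝ} (hp : ∀ m, p m ∈ Set.Icc (0 : ℝ) 1) {M : ℝ}
    {f : Config N → ℝ} (hf : ∀ x y, f x - f y ≤ M) (x y : Config N) (i : ZMod N) :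
    (p (nbrIndex x i) * f (Function.update x i 1) +
        (1 - p (nbrIndex x i)) * f (Function.update x i 0)) -
      (p (nbrIndex y i) * f (Function.update y i 1) +
        (1 - p (nbrIndex y i)) * f (Function.update y i 0)) ≤ M := by
  have ha := hp (nbrIndex x i)
  have hb := hp (nbrIndex y i)
  generalize p (nbrIndex x i) = a at *
  generalize p (nbrIndex y i) = b at *
  obtain ⟨ha0, ha1⟩ := ha
  obtain ⟨hb0, hb1⟩ := hb
  have h11 := hf (Function.update x i 1) (Function.update y i 1)
  have h10 := hf (Function.update x i 1) (Function.update y i 0)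
  have h01 := hf (Function.update x i 0) (Function.update y i 1)
  have h00 := hf (Function.update x i 0) (Function.update y i 0)
  have e1 := mul_le_mul_of_nonneg_left h11 (mul_nonneg ha0 hb0)
  have e2 := mul_le_mul_of_nonneg_left h10 (mul_nonneg ha0 (sub_nonneg.2 hb1))
  have e3 := mul_le_mul_of_nonneg_left h01 (mul_nonneg (sub_nonneg.2 ha1) hb0)
  have e4 := mul_le_mul_of_nonneg_left h00 (mul_nonneg (sub_nonneg.2 ha1) (sub_nonneg.2 hb1))
  linarith

variable [NeZero N]

theorem gameB_mulVec (p : Fin 4 → ℝ) (f : Config N → ℝ) (x : Config N) :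
    (gameB N p *ᵥ f) x = (N : ℝ)⁻¹ * ∑ i : ZMod N,
      (p (nbrIndex x i) * f (Function.update x i 1) +
        (1 - p (nbrIndex x i)) * f (Function.update x i 0)) := by
  have hentry : ∀ y, gameB N p x y = (if y = x then (N : ℝ)⁻¹ * ∑ i : ZMod N, stayProb p x i else 0)
      + ∑ i : ZMod N, if y = flip x i then (N : ℝ)⁻¹ * flipProb p x i else 0 := by
    intro y
    by_cases hy : y = x
    · subst hy
      simp [gameB, flip_ne.symm]
    · simp [gameB, hy]
  simp only [Matrix.mulVec, dotProduct, hentry, add_mul, Finset.sum_mul, ite_mul, zero_mul]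
  rw [Finset.sum_add_distrib, Finset.sum_comm]
  simp only [Finset.sum_ite_eq', Finset.mem_univ, if_true]
  rw [Finset.mul_sum, Finset.sum_mul, ← Finset.sum_add_distrib, Finset.mul_sum]
  refine Finset.sum_congr rfl fun i _ => ?_
  rw [← stayProb_mul_add_flipProb_mul p f]
  ring

theorem gameBStar_mulVec (p : Fin 4 → ℝ) (G : AugState N → ℝ) (x : Config N) (i : ZMod N) :
    (gameBStar N p *ᵥ G) (x, i) = (N : ℝ)⁻¹ * ∑ j : ZMod N,
      (p (nbrIndex x i) * G (Function.update x i 1, j) +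
        (1 - p (nbrIndex x i)) * G (Function.update x i 0, j)) := by
  have hentry : ∀ y j, gameBStar N p (x, i) (y, j) =
      (if y = x then (N : ℝ)⁻¹ * stayProb p x i else 0) +
        if y = flip x i then (N : ℝ)⁻¹ * flipProb p x i else 0 := by
    intro y j
    by_cases hy : y = x
    · subst hy
      simp [gameBStar, flip_ne.symm]
    · simp [gameBStar, hy]
  simp only [Matrix.mulVec, dotProduct, Fintype.sum_prod_type, hentry]
  rw [Finset.sum_comm, Finset.mul_sum]
  refine Finset.sum_congr rfl fun j _ => ?_
  rw [← stayProb_mul_add_flipProb_mul p (fun y => G (y, j))]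
  simp only [add_mul, ite_mul, zero_mul, Finset.sum_add_distrib, Finset.sum_ite_eq',
    Finset.mem_univ, if_true]
  ring

/-- The payoff depends only on the status of player `i` after the play, not on the one before. -/
theorem payoff_update_one (x : Config N) (i j : ZMod N) :
    payoff (x, i) (Function.update x i 1, j) = 1 := by
  obtain h | h : x i = 0 ∨ x i = 1 := by
    generalize x i = a
    fin_cases a <;> simp
  · simp [payoff, flip, h]
  · have h0 : Function.update x i 1 = x := by rw [← h, Function.update_eq_self]
    simp [payoff, flip_ne.symm, h0, h]

theorem payoff_update_zero (x : Config N) (i j : ZMod N) :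
    payoff (x, i) (Function.update x i 0, j) = -1 := by
  obtain h | h : x i = 0 ∨ x i = 1 := by
    generalize x i = a
    fin_cases a <;> simp
  · have h0 : Function.update x i 0 = x := by rw [← h, Function.update_eq_self]
    simp [payoff, flip_ne.symm, h0, h]
  · simp [payoff, flip, h]

theorem gameB_mem_rowStochastic {p : Fin 4 → ℝ} (hp : ∀ m, p m ∈ Set.Icc (0 : ℝ) 1) :
    gameB N p ∈ rowStochastic ℝ (Config N) := by
  have hN : (N : ℝ) ≠ 0 := Nat.cast_ne_zero.2 (NeZero.ne N)
  rw [mem_rowStochastic]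
  refine ⟨fun x y => ?_, ?_⟩
  · have h1 : ∀ i, 0 ≤ stayProb p x i := fun i => by
      have := hp (nbrIndex x i)
      unfold stayProb
      split_ifs <;> linarith [this.1, this.2]
    have h2 : ∀ i, 0 ≤ flipProb p x i := fun i => by
      have := hp (nbrIndex x i)
      unfold flipProb
      split_ifs <;> linarith [this.1, this.2]
    simp only [gameB, Matrix.of_apply]
    split_ifs
    · exact mul_nonneg (by positivity) (Finset.sum_nonneg fun i _ => h1 i)
    · refine Finset.sum_nonneg fun i _ => ?_
      split_ifs
      · exact mul_nonneg (by positivity) (h2 i)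
      · exact le_rfl
  · ext x
    rw [gameB_mulVec]
    simp [ZMod.card, hN]

theorem half_mem_Icc (m : Fin 4) : (fun _ : Fin 4 => (1 / 2 : ℝ)) m ∈ Set.Icc (0 : ℝ) 1 := by
  norm_num

theorem gameA_mem_rowStochastic : gameA N ∈ rowStochastic ℝ (Config N) :=
  gameB_mem_rowStochastic half_mem_Icc

theorem pattern_mem_rowStochastic {p : Fin 4 → ℝ} (hp : ∀ m, p m ∈ Set.Icc (0 : ℝ) 1) (r s : ℕ) :
    gameA N ^ r * gameB N p ^ s ∈ rowStochastic ℝ (Config N) :=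
  mul_mem (pow_mem gameA_mem_rowStochastic r) (pow_mem (gameB_mem_rowStochastic hp) s)

/-! ### Maximal increments, harmonic functions and uniqueness -/

/-- `f` has an increment of at least `M` between two configurations that differ in at most `k`
coordinates. -/
def HasIncrement (M : ℝ) (k : ℕ) (f : Config N → ℝ) : Prop :=
  ∃ x y : Config N, (Finset.univ.filter fun i => x i ≠ y i).card ≤ k ∧ M ≤ f x - f y

theorem HasIncrement.of_le_zero {M : ℝ} (hM : M ≤ 0) (k : ℕ) (f : Config N → ℝ) :
    HasIncrement M k f :=
  ⟨0, 0, by simp, by simpa using hM⟩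

theorem gameB_mulVec_sub_eq (p : Fin 4 → ℝ) (f : Config N → ℝ) (x y : Config N) :
    (gameB N p *ᵥ f) x - (gameB N p *ᵥ f) y = (N : ℝ)⁻¹ * ∑ i : ZMod N,
      ((p (nbrIndex x i) * f (Function.update x i 1) +
        (1 - p (nbrIndex x i)) * f (Function.update x i 0)) -
      (p (nbrIndex y i) * f (Function.update y i 1) +
        (1 - p (nbrIndex y i)) * f (Function.update y i 0))) := by
  rw [gameB_mulVec, gameB_mulVec, Finset.sum_sub_distrib, mul_sub]

theorem gameB_osc_le {p : Fin 4 → ℝ} (hp : ∀ m, p m ∈ Set.Icc (0 : ℝ) 1) {M : ℝ}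
    {f : Config N → ℝ} (hf : ∀ x y, f x - f y ≤ M) (x y : Config N) :
    (gameB N p *ᵥ f) x - (gameB N p *ᵥ f) y ≤ M := by
  have hN : (N : ℝ) ≠ 0 := Nat.cast_ne_zero.2 (NeZero.ne N)
  rw [gameB_mulVec_sub_eq]
  calc _ ≤ (N : ℝ)⁻¹ * ∑ i : ZMod N, M := by
        gcongr with i
        exact gameB_mulVec_sub_le hp hf x y i
    _ = M := by simp [ZMod.card, hN]

/-- If the oscillation bound is attained after one step, then it is attained conditionally on each
choice of the player. -/
theorem le_of_le_gameB_mulVec_sub {p : Fin 4 → ℝ} (hp : ∀ m, p m ∈ Set.Icc (0 : ℝ) 1) {M : ℝ}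
    {f : Config N → ℝ} (hf : ∀ x y, f x - f y ≤ M) {x y : Config N}
    (h : M ≤ (gameB N p *ᵥ f) x - (gameB N p *ᵥ f) y) (i : ZMod N) :
    M ≤ (p (nbrIndex x i) * f (Function.update x i 1) +
        (1 - p (nbrIndex x i)) * f (Function.update x i 0)) -
      (p (nbrIndex y i) * f (Function.update y i 1) +
        (1 - p (nbrIndex y i)) * f (Function.update y i 0)) := by
  have hN : 0 < (N : ℝ) := Nat.cast_pos.2 (NeZero.pos N)
  by_contra hlt
  rw [not_le] at hlt
  rw [gameB_mulVec_sub_eq] at h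
  have hs := Finset.sum_lt_sum (s := Finset.univ) (g := fun _ : ZMod N => M)
    (fun j _ => gameB_mulVec_sub_le hp hf x y j) ⟨i, Finset.mem_univ i, hlt⟩
  have h2 := mul_lt_mul_of_pos_left hs (inv_pos.2 hN)
  have h3 : (N : ℝ)⁻¹ * ∑ _j : ZMod N, M = M := by simp [ZMod.card, hN.ne']
  linarith

/-- Let a player on whom `x` and `y` already disagree play: no new disagreement can arise, and one
of the four increments in the convex combination is at least `M`. -/
theorem HasIncrement.of_gameB {p : Fin 4 → ℝ} (hp : ∀ m, p m ∈ Set.Icc (0 : ℝ) 1) {M : ℝ} {k : ℕ}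
    {f : Config N → ℝ} (hf : ∀ x y, f x - f y ≤ M) (h : HasIncrement M k (gameB N p *ᵥ f)) :
    HasIncrement M k f := by
  obtain ⟨x, y, hk, hM⟩ := h
  by_cases hxy : x = y
  · exact .of_le_zero (by simpa [hxy] using hM) k f
  obtain ⟨i, hi⟩ := Function.ne_iff.1 hxy
  have hi' := le_of_le_gameB_mulVec_sub hp hf hM i
  have hcard : ∀ a b, (Finset.univ.filter fun j =>
      Function.update x i a j ≠ Function.update y i b j).card ≤ k := by
    intro a b
    refine (Finset.card_le_card fun j hj => ?_).trans hk
    simp only [Finset.mem_filter, Finset.mem_univ, true_and] at hj ⊢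
    by_cases hji : j = i
    · rwa [hji]
    · simpa [hji] using hj
  by_contra hno
  have hlt : ∀ a b, f (Function.update x i a) - f (Function.update y i b) < M := fun a b =>
    lt_of_not_ge fun hab => hno ⟨_, _, hcard a b, hab⟩
  -- A uniform gap below `M` keeps the convex combination strictly below `M`, whichever weights
  -- vanish.
  obtain ⟨M', hM', hlt'⟩ : ∃ M' < M, ∀ a b,
      f (Function.update x i a) - f (Function.update y i b) ≤ M' := by
    let F : Fin 2 × Fin 2 → ℝ := fun q => f (Function.update x i q.1) - f (Function.update y i q.2)
    obtain ⟨q, hq⟩ := Finite.exists_max F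
    exact ⟨F q, hlt _ _, fun a b => hq (a, b)⟩
  have ha := hp (nbrIndex x i)
  have hb := hp (nbrIndex y i)
  generalize p (nbrIndex x i) = a at *
  generalize p (nbrIndex y i) = b at *
  obtain ⟨ha0, ha1⟩ := ha
  obtain ⟨hb0, hb1⟩ := hb
  have e1 := mul_le_mul_of_nonneg_left (hlt' 1 1) (mul_nonneg ha0 hb0)
  have e2 := mul_le_mul_of_nonneg_left (hlt' 1 0) (mul_nonneg ha0 (sub_nonneg.2 hb1))
  have e3 := mul_le_mul_of_nonneg_left (hlt' 0 1) (mul_nonneg (sub_nonneg.2 ha1) hb0)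
  have e4 := mul_le_mul_of_nonneg_left (hlt' 0 0)
    (mul_nonneg (sub_nonneg.2 ha1) (sub_nonneg.2 hb1))
  linarith

/-- With all parameters `1/2` the chosen player can receive the same new status in both
configurations. The two resulting increments are at most `M` and average at least `M`, so both equal
`M`, and the disagreement at `i` is gone. -/
theorem HasIncrement.of_gameA {M : ℝ} {k : ℕ} {f : Config N → ℝ} (hf : ∀ x y, f x - f y ≤ M)
    (h : HasIncrement M (k + 1) (gameA N *ᵥ f)) : HasIncrement M k f := by
  obtain ⟨x, y, hk, hM⟩ := h
  by_cases hxy : x = y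
  · exact .of_le_zero (by simpa [hxy] using hM) k f
  obtain ⟨i, hi⟩ := Function.ne_iff.1 hxy
  have hi' := le_of_le_gameB_mulVec_sub half_mem_Icc hf hM i
  refine ⟨Function.update x i 1, Function.update y i 1, ?_, ?_⟩
  · have hss : (Finset.univ.filter fun j =>
        Function.update x i 1 j ≠ Function.update y i 1 j) ⊂
        Finset.univ.filter fun j => x j ≠ y j := by
      rw [Finset.ssubset_iff_of_subset]
      · exact ⟨i, by simpa using hi, by simp⟩
      · intro j hj
        simp only [Finset.mem_filter, Finset.mem_univ, true_and] at hj ⊢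
        by_cases hji : j = i
        · rwa [hji]
        · simpa [hji] using hj
    have := Finset.card_lt_card hss
    omega
  · have := hf (Function.update x i 0) (Function.update y i 0)
    linarith

theorem HasIncrement.of_gameB_pow {p : Fin 4 → ℝ} (hp : ∀ m, p m ∈ Set.Icc (0 : ℝ) 1) {M : ℝ}
    {k : ℕ} (s : ℕ) {f : Config N → ℝ} (hf : ∀ x y, f x - f y ≤ M) :
    (∀ x y, (gameB N p ^ s *ᵥ f) x - (gameB N p ^ s *ᵥ f) y ≤ M) ∧
      (HasIncrement M k (gameB N p ^ s *ᵥ f) → HasIncrement M k f) := by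
  induction s with
  | zero => simpa using hf
  | succ s ih =>
    rw [pow_succ', ← Matrix.mulVec_mulVec]
    exact ⟨gameB_osc_le hp ih.1, fun h => ih.2 (h.of_gameB hp ih.1)⟩

/-- The harmonic functions of `P_A^r P_B^s` are constant if `r ≥ 1`. -/
theorem eq_of_pattern_mulVec_eq {p : Fin 4 → ℝ} (hp : ∀ m, p m ∈ Set.Icc (0 : ℝ) 1) {r : ℕ}
    (hr : 1 ≤ r) (s : ℕ) {h : Config N → ℝ} (hh : (gameA N ^ r * gameB N p ^ s) *ᵥ h = h)
    (x y : Config N) : h x = h y := by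
  obtain ⟨q, hq⟩ := Finite.exists_max fun q : Config N × Config N => h q.1 - h q.2
  set M := h q.1 - h q.2 with hM
  have hf : ∀ x y, h x - h y ≤ M := fun x y => hq (x, y)
  have hstep : ∀ k, HasIncrement M (k + 1) h → HasIncrement M k h := by
    intro k hk
    have hB := HasIncrement.of_gameB_pow hp (k := k) s hf
    have hA := HasIncrement.of_gameB_pow half_mem_Icc (k := k) (r - 1) hB.1
    -- Only the first `A` of the period is used to lower `k`; the other `r - 1` games `A` and all
    -- games `B` merely preserve it.
    refine hB.2 (hA.2 (HasIncrement.of_gameA hA.1 ?_))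
    rw [← gameA, Matrix.mulVec_mulVec, Matrix.mulVec_mulVec, ← pow_succ',
      Nat.sub_add_cancel hr, hh]
    exact hk
  have hall : ∀ k, HasIncrement M k h → HasIncrement M 0 h := by
    intro k
    induction k with
    | zero => exact id
    | succ k ih => exact fun hk => ih (hstep k hk)
  obtain ⟨x', y', hxy, hM'⟩ := hall _ ⟨q.1, q.2, le_rfl, hM.le⟩
  have hxy' : x' = y' := by
    ext1 i
    by_contra hne
    have hi : i ∈ Finset.univ.filter fun i => x' i ≠ y' i := by simpa using hne
    have := Finset.card_pos.2 ⟨i, hi⟩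
    omega
  rw [hxy', sub_self] at hM'
  linarith [hf x y, hf y x]

theorem existsUnique_isStationaryDistribution {p : Fin 4 → ℝ} (hp : ∀ m, p m ∈ Set.Icc (0 : ℝ) 1)
    {r : ℕ} (hr : 1 ≤ r) (s : ℕ) :
    ∃! π : Config N → ℝ, IsStationaryDistribution (gameA N ^ r * gameB N p ^ s) π := by
  have hQ := pattern_mem_rowStochastic (N := N) hp r s
  obtain ⟨π, hπ⟩ := exists_isStationaryDistribution hQ
  exact ⟨π, hπ, fun π' hπ' => hπ.unique (fun h hh => eq_of_pattern_mulVec_eq hp hr s hh) hπ'⟩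

end Game

/-! ### Strong law for additive functionals of a Markov chain -/

section LLN

/-- If a sequence with bounded increments is `o(m ^ 2)` along the squares, then it is `o(n)`. -/
theorem tendsto_inv_mul_of_tendsto_sq {u : ℕ → ℝ} {C : ℝ} (hC : ∀ n, |u (n + 1) - u n| ≤ C)
    (hu : Tendsto (fun m : ℕ => ((m ^ 2 : ℕ) : ℝ)⁻¹ * u (m ^ 2)) atTop (𝓝 0)) :
    Tendsto (fun n : ℕ => (n : ℝ)⁻¹ * u n) atTop (𝓝 0) := by
  have hC0 : 0 ≤ C := (abs_nonneg _).trans (hC 0)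
  have hadd : ∀ n k, |u (n + k) - u n| ≤ C * k := by
    intro n k
    induction k with
    | zero => simp
    | succ k ih =>
      have := abs_add_le (u (n + k + 1) - u (n + k)) (u (n + k) - u n)
      rw [sub_add_sub_cancel] at this
      rw [← add_assoc]
      push_cast
      linarith [hC (n + k)]
  have hsqrt : Tendsto Nat.sqrt atTop atTop :=
    tendsto_atTop.2 fun b => eventually_atTop.2 ⟨b * b, fun n hn => Nat.le_sqrt.2 hn⟩
  have hbound : Tendsto (fun m : ℕ => |((m ^ 2 : ℕ) : ℝ)⁻¹ * u (m ^ 2)| + 2 * C * (m : ℝ)⁻¹)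
      atTop (𝓝 0) := by
    have h1 := hu.abs
    have h2 := (tendsto_inv_atTop_nhds_zero_nat (𝕜 := ℝ)).const_mul (2 * C)
    simpa using h1.add h2
  refine squeeze_zero_norm' ?_ (hbound.comp hsqrt)
  filter_upwards [eventually_ge_atTop 1] with n hn
  have hm : 1 ≤ Nat.sqrt n := Nat.le_sqrt.2 (by simpa using hn)
  have h1 : Nat.sqrt n ^ 2 ≤ n := Nat.sqrt_le' n
  -- The gap to the preceding square is `O(√n)`, so bounded increments change `u n / n` negligibly
  -- in between.
  have h2 : n - Nat.sqrt n ^ 2 ≤ 2 * Nat.sqrt n := by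
    have := Nat.sqrt_le_add n
    rw [pow_two]
    omega
  simp only [Function.comp_apply, Real.norm_eq_abs]
  generalize Nat.sqrt n = m at *
  have h3 := hadd (m ^ 2) (n - m ^ 2)
  rw [Nat.add_sub_cancel' h1] at h3
  have h4 : |u n| ≤ |u (m ^ 2)| + C * (2 * m) := by
    have e1 := abs_add_le (u n - u (m ^ 2)) (u (m ^ 2))
    rw [sub_add_cancel] at e1
    have e2 : ((n - m ^ 2 : ℕ) : ℝ) ≤ 2 * m := by exact_mod_cast h2
    have e3 := mul_le_mul_of_nonneg_left e2 hC0
    linarith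
  have hm0 : (0 : ℝ) < m := by exact_mod_cast hm
  have hn0 : (0 : ℝ) < n := by exact_mod_cast hn
  have hmn : ((m ^ 2 : ℕ) : ℝ) ≤ n := by exact_mod_cast h1
  rw [abs_mul, abs_mul, abs_of_pos (inv_pos.2 hn0), abs_of_nonneg (by positivity :
    (0 : ℝ) ≤ ((m ^ 2 : ℕ) : ℝ)⁻¹)]
  have hinv : (n : ℝ)⁻¹ ≤ ((m ^ 2 : ℕ) : ℝ)⁻¹ := by
    apply inv_anti₀ _ hmn
    push_cast
    positivity
  calc (n : ℝ)⁻¹ * |u n| ≤ ((m ^ 2 : ℕ) : ℝ)⁻¹ * (|u (m ^ 2)| + C * (2 * m)) :=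
        mul_le_mul hinv h4 (abs_nonneg _) (by positivity)
    _ = ((m ^ 2 : ℕ) : ℝ)⁻¹ * |u (m ^ 2)| + 2 * C * (m : ℝ)⁻¹ := by
        push_cast
        field_simp

variable {Ω : Type*} [MeasurableSpace Ω]

/-- The expectation of a function of a random element of a finite set. -/
theorem integral_comp_eq_sum_real {T : Type*} [Fintype T] {ℙ : Measure Ω} [IsFiniteMeasure ℙ]
    {Z : Ω → T} (hZ : ∀ t, MeasurableSet {ω | Z ω = t}) (G : T → ℝ) :
    ∫ ω, G (Z ω) ∂ℙ = ∑ t, ℙ.real {ω | Z ω = t} * G t := by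
  classical
  have h1 : ∀ ω, G (Z ω) = ∑ t, Set.indicator {ω | Z ω = t} (fun _ => G t) ω := by
    intro ω
    simp [Set.indicator_apply]
  simp_rw [h1]
  rw [integral_finsetSum]
  · refine Finset.sum_congr rfl fun t _ => ?_
    rw [integral_indicator_const _ (hZ t), smul_eq_mul]
  · exact fun t _ => (integrable_const _).indicator (hZ t)

/-- An `L²` criterion for almost sure convergence along the squares. -/
theorem ae_tendsto_sq_of_integral_sq_le {ℙ : Measure Ω} [IsProbabilityMeasure ℙ]
    {M : ℕ → Ω → ℝ} {C : ℝ} (hM : ∀ n, Integrable (fun ω => M n ω ^ 2) ℙ)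
    (hC : ∀ n : ℕ, ∫ ω, M n ω ^ 2 ∂ℙ ≤ n * C) :
    ∀ᵐ ω ∂ℙ, Tendsto (fun m : ℕ => ((m ^ 2 : ℕ) : ℝ)⁻¹ * M (m ^ 2) ω) atTop (𝓝 0) := by
  set F : ℕ → Ω → ℝ := fun m ω => (((m ^ 2 : ℕ) : ℝ)⁻¹ * M (m ^ 2) ω) ^ 2 with hF
  have hF0 : ∀ m ω, 0 ≤ F m ω := fun m ω => sq_nonneg _
  have hFi : ∀ m, Integrable (F m) ℙ := by
    intro m
    simp only [hF, mul_pow]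
    exact (hM _).const_mul _
  have hFb : ∀ m : ℕ, ∫ ω, F m ω ∂ℙ ≤ C * (1 / (m : ℝ) ^ 2) := by
    intro m
    simp only [hF, mul_pow]
    rw [integral_const_mul]
    rcases Nat.eq_zero_or_pos m with rfl | hm
    · simp
    have hm0 : (0 : ℝ) < m := by exact_mod_cast hm
    calc _ ≤ ((((m ^ 2 : ℕ) : ℝ)⁻¹) ^ 2) * (((m ^ 2 : ℕ) : ℝ) * C) := by
          gcongr
          exact hC _
      _ = C * (1 / (m : ℝ) ^ 2) := by
          push_cast
          field_simp
  have hsum : Summable fun m => ∫ ω, F m ω ∂ℙ :=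
    Summable.of_nonneg_of_le (fun m => integral_nonneg (hF0 m)) hFb
      ((Real.summable_one_div_nat_pow.2 one_lt_two).mul_left C)
  -- By Tonelli the random series has finite mean; it therefore converges almost surely and its
  -- terms tend to `0`.
  have hlint : ∫⁻ ω, ∑' m, ENNReal.ofReal (F m ω) ∂ℙ ≠ ⊤ := by
    rw [lintegral_tsum fun m => (hFi m).aestronglyMeasurable.aemeasurable.ennreal_ofReal]
    have : ∀ m, ∫⁻ ω, ENNReal.ofReal (F m ω) ∂ℙ = ENNReal.ofReal (∫ ω, F m ω ∂ℙ) := fun m =>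
      (ofReal_integral_eq_lintegral_ofReal (hFi m) (ae_of_all _ (hF0 m))).symm
    simp_rw [this]
    exact hsum.tsum_ofReal_ne_top
  have hae := ae_lt_top' (AEMeasurable.tsum fun m =>
    (hFi m).aestronglyMeasurable.aemeasurable.ennreal_ofReal) hlint
  filter_upwards [hae] with ω hω
  have h1 := ENNReal.tendsto_atTop_zero_of_tsum_ne_top hω.ne
  have h2 : Tendsto (fun m => F m ω) atTop (𝓝 0) := by
    have := (ENNReal.tendsto_toReal ENNReal.zero_ne_top).comp h1
    simpa [Function.comp_def, ENNReal.toReal_ofReal (hF0 _ _)] using this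
  have h3 := (Real.continuous_sqrt.tendsto 0).comp h2
  simp only [Function.comp_def, hF, Real.sqrt_sq_eq_abs, Real.sqrt_zero] at h3
  exact (tendsto_zero_iff_abs_tendsto_zero _).2 h3

variable {S : Type*} {Q : ℕ → Matrix S S ℝ} {ℙ : Measure Ω} {X : ℕ → Ω → S}

theorem IsMarkovChain.measurableSet_path (hX : IsMarkovChain Q ℙ X) (n : ℕ) (a : ℕ → S) :
    MeasurableSet {ω | ∀ k ≤ n, X k ω = a k} := by
  have : {ω | ∀ k ≤ n, X k ω = a k} = ⋂ k ∈ Finset.range (n + 1), {ω | X k ω = a k} := by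
    ext ω
    simp
  rw [this]
  exact Finset.measurableSet_biInter _ fun k _ => hX.measurable k (a k)

variable [Fintype S] [IsProbabilityMeasure ℙ]

/-- A function of the past is orthogonal to a martingale difference. -/
theorem IsMarkovChain.integral_mul_eq_zero (hX : IsMarkovChain Q ℙ X) (n : ℕ)
    {d : S → S → ℝ} (hd : ∀ a, ∑ b, Q n a b * d a b = 0) (F : (Fin (n + 1) → S) → ℝ) :
    ∫ ω, F (fun k => X k ω) * d (X n ω) (X (n + 1) ω) ∂ℙ = 0 := by
  -- The past `z` followed by the next state `b`; the values beyond `n + 1` are never consulted.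
  let path : (Fin (n + 1) → S) → S → ℕ → S := fun z b k => if h : k < n + 1 then z ⟨k, h⟩ else b
  let Z : Ω → (Fin (n + 1) → S) × S := fun ω => (fun k => X k ω, X (n + 1) ω)
  have hset : ∀ z b, {ω | Z ω = (z, b)} = {ω | ∀ k ≤ n + 1, X k ω = path z b k} := by
    intro z b
    ext1 ω
    simp only [Set.mem_ofPred_eq, Z, path, Prod.mk.injEq, funext_iff]
    constructor
    · rintro ⟨h1, h2⟩ k hk
      split_ifs with hk'
      · exact h1 ⟨k, hk'⟩
      · rw [show k = n + 1 by omega]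
        exact h2
    · intro h
      refine ⟨fun k => ?_, ?_⟩
      · have := h k (by omega)
        rwa [dif_pos k.2] at this
      · have := h (n + 1) le_rfl
        rwa [dif_neg (by omega)] at this
  have hpast : ∀ z b b', {ω | ∀ k ≤ n, X k ω = path z b k} = {ω | ∀ k ≤ n, X k ω = path z b' k} := by
    intro z b b'
    ext1 ω
    simp only [Set.mem_ofPred_eq, path]
    refine forall₂_congr fun k hk => ?_
    rw [dif_pos (by omega), dif_pos (by omega)]
  have hint := integral_comp_eq_sum_real (ℙ := ℙ) (Z := Z)
    (fun t => by rw [hset t.1 t.2]; exact hX.measurableSet_path _ _)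
    (fun t => F t.1 * d (t.1 (Fin.last n)) t.2)
  have hlast : ∀ z b, path z b n = z (Fin.last n) := fun z b => by
    simp only [path]
    rw [dif_pos (by omega)]
    rfl
  have hnew : ∀ z b, path z b (n + 1) = b := fun z b => by
    simp only [path]
    rw [dif_neg (by omega)]
  refine hint.trans ?_
  rw [Fintype.sum_prod_type]
  refine Finset.sum_eq_zero fun z _ => ?_
  simp only [hset, hX.step, hlast, hnew]
  -- The event of the past does not depend on `b`; a fixed filler lets its probability leave the
  -- sum.
  have b₀ := z 0
  calc _ = ∑ b, ℙ.real {ω | ∀ k ≤ n, X k ω = path z b₀ k} * F z *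
        (Q n (z (Fin.last n)) b * d (z (Fin.last n)) b) := by
        refine Finset.sum_congr rfl fun b _ => ?_
        rw [hpast z b b₀]
        ring
    _ = 0 := by rw [← Finset.mul_sum, hd, mul_zero]

theorem IsMarkovChain.integrable_path (hX : IsMarkovChain Q ℙ X) (n : ℕ)
    (F : (Fin (n + 1) → S) → ℝ) : Integrable (fun ω => F fun k => X k ω) ℙ := by
  let : MeasurableSpace S := ⊤
  have hm : ∀ k, Measurable (X k) := fun k =>
    measurable_to_countable' fun a => hX.measurable k a
  refine Integrable.of_finite.comp_measurable (f := fun ω (k : Fin (n + 1)) => X k ω) ?_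
  exact measurable_pi_lambda _ fun k => hm k

/-- The law of large numbers for bounded martingale differences along a Markov chain. -/
theorem IsMarkovChain.ae_tendsto_of_sum_eq_zero (hX : IsMarkovChain Q ℙ X)
    {d : ℕ → S → S → ℝ} {C : ℝ} (hC : ∀ n a b, |d n a b| ≤ C)
    (hd : ∀ n a, ∑ b, Q n a b * d n a b = 0) :
    ∀ᵐ ω ∂ℙ, Tendsto (fun n : ℕ => (n : ℝ)⁻¹ *
      ∑ k ∈ Finset.range n, d k (X k ω) (X (k + 1) ω)) atTop (𝓝 0) := by
  set M : ℕ → Ω → ℝ := fun n ω => ∑ k ∈ Finset.range n, d k (X k ω) (X (k + 1) ω) with hM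
  let F : (n : ℕ) → (Fin (n + 1) → S) → ℝ := fun n z =>
    ∑ k : Fin n, d k (z k.castSucc) (z k.succ)
  have hMF : ∀ n ω, M n ω = F n fun k => X k ω := by
    intro n ω
    simp only [hM, F, Finset.sum_range, Fin.val_castSucc, Fin.val_succ]
  have hsq : ∀ n, Integrable (fun ω => M n ω ^ 2) ℙ := by
    intro n
    simp only [hMF]
    exact hX.integrable_path n fun z => F n z ^ 2
  have hdi : ∀ n, Integrable (fun ω => d n (X n ω) (X (n + 1) ω) ^ 2) ℙ := fun n =>
    hX.integrable_path (n + 1) fun z => d n (z (Fin.last n).castSucc) (z (Fin.last (n + 1))) ^ 2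
  have hci : ∀ n, Integrable (fun ω => M n ω * d n (X n ω) (X (n + 1) ω)) ℙ := by
    intro n
    simp only [hMF]
    exact hX.integrable_path (n + 1) fun z => F n (fun k => z k.castSucc) *
      d n (z (Fin.last n).castSucc) (z (Fin.last (n + 1)))
  have hbound : ∀ n : ℕ, ∫ ω, M n ω ^ 2 ∂ℙ ≤ n * C ^ 2 := by
    intro n
    induction n with
    | zero => simp [hM]
    | succ n ih =>
      have h1 : ∀ ω, M (n + 1) ω ^ 2 = M n ω ^ 2 + 2 * (M n ω * d n (X n ω) (X (n + 1) ω)) +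
          d n (X n ω) (X (n + 1) ω) ^ 2 := by
        intro ω
        simp only [hM, Finset.sum_range_succ]
        ring
      -- Orthogonality of increments makes the second moment grow at most linearly.
      have h2 : ∫ ω, M n ω * d n (X n ω) (X (n + 1) ω) ∂ℙ = 0 := by
        simp only [hMF]
        exact hX.integral_mul_eq_zero n (hd n) (F n)
      have h3 : ∫ ω, d n (X n ω) (X (n + 1) ω) ^ 2 ∂ℙ ≤ C ^ 2 := by
        have := integral_mono (hdi n) (integrable_const (C ^ 2)) fun ω =>
          sq_le_sq' (abs_le.1 (hC n (X n ω) (X (n + 1) ω))).1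
            (abs_le.1 (hC n (X n ω) (X (n + 1) ω))).2
        simpa using this
      have h4 : Integrable (fun ω => M n ω ^ 2 + 2 * (M n ω * d n (X n ω) (X (n + 1) ω))) ℙ :=
        (hsq n).add ((hci n).const_mul 2)
      simp_rw [h1]
      rw [integral_add h4 (hdi n),
        integral_add (hsq n) ((hci n).const_mul 2), integral_const_mul, h2]
      push_cast
      linarith
  filter_upwards [ae_tendsto_sq_of_integral_sq_le hsq hbound] with ω hω
  refine tendsto_inv_mul_of_tendsto_sq (u := fun n => M n ω) (C := C) (fun n => ?_) hω
  simpa [hM, Finset.sum_range_succ] using hC n _ _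

/-- The law of large numbers for additive functionals of a Markov chain, given a bounded solution of
the Poisson equation. -/
theorem IsMarkovChain.ae_tendsto_of_poisson (hX : IsMarkovChain Q ℙ X)
    {w : S → S → ℝ} {g : ℕ → S → ℝ} {μ C D : ℝ} (hw : ∀ a b, |w a b| ≤ D)
    (hg : ∀ n a, |g n a| ≤ C)
    (hP : ∀ n a, ∑ b, Q n a b * (w a b - μ - g n a + g (n + 1) b) = 0) :
    ∀ᵐ ω ∂ℙ, Tendsto (fun n : ℕ => (n : ℝ)⁻¹ *
      ∑ k ∈ Finset.range n, w (X k ω) (X (k + 1) ω)) atTop (𝓝 μ) := by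
  have hb : ∀ n a b, |w a b - μ - g n a + g (n + 1) b| ≤ D + |μ| + C + C := by
    intro n a b
    have h1 := abs_add_le (w a b - μ - g n a) (g (n + 1) b)
    have h2 := abs_sub (w a b - μ) (g n a)
    have h3 := abs_sub (w a b) μ
    linarith [hw a b, hg n a, hg (n + 1) b]
  filter_upwards [hX.ae_tendsto_of_sum_eq_zero hb hP] with ω hω
  have hrest : Tendsto (fun n : ℕ => (n : ℝ)⁻¹ * (g 0 (X 0 ω) - g n (X n ω))) atTop (𝓝 0) := by
    have hlim := (tendsto_inv_atTop_nhds_zero_nat (𝕜 := ℝ)).mul_const (C + C)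
    rw [zero_mul] at hlim
    refine squeeze_zero_norm (fun n => ?_) hlim
    rw [norm_mul, Real.norm_eq_abs, Real.norm_eq_abs, abs_of_nonneg (by positivity :
      (0 : ℝ) ≤ (n : ℝ)⁻¹)]
    gcongr
    exact (abs_sub _ _).trans (add_le_add (hg _ _) (hg _ _))
  have htot := (hω.add hrest).add_const μ
  rw [add_zero, zero_add] at htot
  refine htot.congr' ?_
  filter_upwards [eventually_ge_atTop 1] with n hn
  have hn0 : (n : ℝ) ≠ 0 := by positivity
  -- The corrector terms telescope, leaving only the bounded boundary values of `g`.
  have htel : ∑ k ∈ Finset.range n, (w (X k ω) (X (k + 1) ω) - μ - g k (X k ω) +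
      g (k + 1) (X (k + 1) ω)) = ∑ k ∈ Finset.range n, w (X k ω) (X (k + 1) ω) - n * μ +
        (g n (X n ω) - g 0 (X 0 ω)) := by
    rw [← Finset.sum_range_sub fun k => g k (X k ω)]
    simp only [Finset.sum_add_distrib, Finset.sum_sub_distrib, Finset.sum_const, Finset.card_range,
      nsmul_eq_mul]
    ring
  rw [htel]
  field_simp
  ring

end LLN

/-! ### Rotation invariance -/

section Shift

variable {N : ℕ}

/-- The rotation of a configuration by `c` positions. -/
def shift (c : ZMod N) : Config N ≃ Config N where
  toFun x i := x (i + c)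
  invFun x i := x (i - c)
  left_inv x := by simp
  right_inv x := by simp

theorem shift_apply (c : ZMod N) (x : Config N) (i : ZMod N) : shift c x i = x (i + c) := rfl

theorem nbrIndex_shift (c : ZMod N) (x : Config N) (i : ZMod N) :
    nbrIndex (shift c x) i = nbrIndex x (i + c) := by
  simp only [nbrIndex, shift_apply]
  rw [show i - 1 + c = i + c - 1 by ring, show i + 1 + c = i + c + 1 by ring]

theorem shift_update (c : ZMod N) (x : Config N) (i : ZMod N) (a : Fin 2) :
    Function.update (shift c x) i a = shift c (Function.update x (i + c) a) := by
  ext1 j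
  simp only [shift_apply, Function.update_apply, add_left_inj]

variable [NeZero N]

/-- Invariance of a matrix on configurations under rotations. -/
def CommutesWithShift (Q : Matrix (Config N) (Config N) ℝ) : Prop :=
  ∀ (c : ZMod N) (f : Config N → ℝ), Q *ᵥ (f ∘ shift c) = (Q *ᵥ f) ∘ shift c

/-- Invariance of a vector indexed by configurations under rotations. -/
def ShiftInvariant (ν : Config N → ℝ) : Prop :=
  ∀ (c : ZMod N) (f : Config N → ℝ), ν ⬝ᵥ (f ∘ shift c) = ν ⬝ᵥ f

theorem CommutesWithShift.mul {Q Q' : Matrix (Config N) (Config N) ℝ} (h : CommutesWithShift Q)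
    (h' : CommutesWithShift Q') : CommutesWithShift (Q * Q') := by
  intro c f
  rw [← Matrix.mulVec_mulVec, h', h, Matrix.mulVec_mulVec]

theorem CommutesWithShift.pow {Q : Matrix (Config N) (Config N) ℝ} (h : CommutesWithShift Q)
    (n : ℕ) : CommutesWithShift (Q ^ n) := by
  induction n with
  | zero => intro c f; simp
  | succ n ih => rw [pow_succ]; exact ih.mul h

theorem commutesWithShift_gameB (p : Fin 4 → ℝ) : CommutesWithShift (gameB N p) := by
  intro c f
  ext x
  rw [Function.comp_apply, gameB_mulVec, gameB_mulVec]
  congr 1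
  simp only [Function.comp_apply, nbrIndex_shift, shift_update]
  exact (Equiv.sum_comp (Equiv.addRight c) fun i => p (nbrIndex x i) *
    f (shift c (Function.update x i 1)) + (1 - p (nbrIndex x i)) *
    f (shift c (Function.update x i 0))).symm

theorem commutesWithShift_gameA : CommutesWithShift (gameA N) :=
  commutesWithShift_gameB _

theorem commutesWithShift_pattern (p : Fin 4 → ℝ) (r s : ℕ) :
    CommutesWithShift (gameA N ^ r * gameB N p ^ s) :=
  (commutesWithShift_gameA.pow r).mul ((commutesWithShift_gameB p).pow s)

theorem ShiftInvariant.vecMul {ν : Config N → ℝ} (hν : ShiftInvariant ν)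
    {Q : Matrix (Config N) (Config N) ℝ} (hQ : CommutesWithShift Q) : ShiftInvariant (ν ᵥ* Q) := by
  intro c f
  rw [← dotProduct_mulVec, hQ, hν, dotProduct_mulVec]

/-- A rotated stationary distribution is again stationary, hence equal to the original by
uniqueness. -/
theorem IsStationaryDistribution.shiftInvariant {Q : Matrix (Config N) (Config N) ℝ}
    (hQ : CommutesWithShift Q) (hu : ∃! π, IsStationaryDistribution Q π) {π : Config N → ℝ}
    (hπ : IsStationaryDistribution Q π) : ShiftInvariant π := by
  intro c f
  have hπ' : IsStationaryDistribution Q (π ∘ (shift c).symm) := by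
    refine ⟨⟨fun x => hπ.1.1 _, ?_⟩, ?_⟩
    · rw [← hπ.1.2]
      exact Equiv.sum_comp (shift c).symm π
    · refine dotProduct_eq _ _ fun g => ?_
      rw [← dotProduct_mulVec, comp_equiv_symm_dotProduct, comp_equiv_symm_dotProduct, ← hQ,
        dotProduct_mulVec, hπ.2]
  rw [← comp_equiv_symm_dotProduct, hu.unique hπ' hπ]

end Shift

/-! ### Drift, mean sign and marginals -/

section Marginals

variable {N : ℕ}

/-- The conditional mean payoff, given that player `i` plays in the configuration `x`. -/
def drift (p : Fin 4 → ℝ) (i : ZMod N) (x : Config N) : ℝ :=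
  p (nbrIndex x i) - (1 - p (nbrIndex x i))

/-- The status of player `i` as a sign. -/
def sign (i : ZMod N) (x : Config N) : ℝ := if x i = 1 then 1 else -1

variable [NeZero N]

/-- The conditional mean payoff, given the configuration `x`. -/
noncomputable def meanDrift (p : Fin 4 → ℝ) (x : Config N) : ℝ :=
  1 / (N : ℝ) * ∑ i : ZMod N, drift p i x

theorem meanDrift_half : meanDrift (N := N) (fun _ => 1 / 2) = 0 := by
  ext x
  norm_num [meanDrift, drift]

theorem marginal₁_sub (ν : Config N → ℝ) (i : ZMod N) :
    marginal₁ ν i 1 - marginal₁ ν i 0 = ν ⬝ᵥ sign i := by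
  simp only [marginal₁, dotProduct, ← Finset.sum_sub_distrib]
  refine Finset.sum_congr rfl fun x _ => ?_
  simp only [sign]
  generalize x i = a
  fin_cases a <;> simp

theorem ShiftInvariant.dotProduct_sum {ν : Config N → ℝ} (hν : ShiftInvariant ν)
    {f : ZMod N → Config N → ℝ} (hf : ∀ c i x, f i (shift c x) = f (i + c) x) (k : ZMod N) :
    ν ⬝ᵥ (fun x => ∑ i, f i x) = N * (ν ⬝ᵥ f k) := by
  have h1 : ∀ i, ν ⬝ᵥ f i = ν ⬝ᵥ f k := by
    intro i
    rw [← hν (i - k) (f k)]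
    congr 1
    ext x
    simp [hf]
  have h2 : (fun x => ∑ i, f i x) = ∑ i, f i := by
    ext x
    simp
  rw [h2, _root_.dotProduct_sum]
  simp [h1, ZMod.card]

theorem ShiftInvariant.dotProduct_meanDrift {ν : Config N → ℝ} (hν : ShiftInvariant ν)
    (p : Fin 4 → ℝ) (k : ZMod N) : ν ⬝ᵥ meanDrift p = ν ⬝ᵥ drift p k := by
  have hN : (N : ℝ) ≠ 0 := Nat.cast_ne_zero.2 (NeZero.ne N)
  have h1 := hν.dotProduct_sum (f := drift p) (fun c i x => by simp [drift, nbrIndex_shift]) k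
  have h2 : (meanDrift p : Config N → ℝ) = (1 / (N : ℝ)) • fun x => ∑ i, drift p i x := rfl
  rw [h2, dotProduct_smul, h1, smul_eq_mul]
  field_simp

theorem sum_marginal₂_mul (ν : Config N → ℝ) (p : Fin 4 → ℝ) :
    ∑ w : Fin 2, ∑ z : Fin 2, marginal₂ ν 1 3 w z *
      (p (pairIndex w z) - (1 - p (pairIndex w z))) = ν ⬝ᵥ drift p 2 := by
  have h1 : ∀ x : Config N, drift p 2 x =
      p (pairIndex (x 1) (x 3)) - (1 - p (pairIndex (x 1) (x 3))) := by
    intro x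
    simp only [drift, nbrIndex]
    -- Coordinates `1` and `3` are the neighbours of player `2`.
    rw [show (2 : ZMod N) - 1 = 1 by ring, show (2 : ZMod N) + 1 = 3 by ring]
  simp only [marginal₂, dotProduct, h1, Finset.sum_mul]
  have h2 : ∀ w : Fin 2, ∑ z : Fin 2, ∑ x : Config N, (if x 1 = w ∧ x 3 = z then ν x else 0) *
      (p (pairIndex w z) - (1 - p (pairIndex w z))) = ∑ x : Config N, ∑ z : Fin 2,
      (if x 1 = w ∧ x 3 = z then ν x else 0) *
      (p (pairIndex w z) - (1 - p (pairIndex w z))) := fun w => Finset.sum_comm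
  simp only [h2]
  rw [Finset.sum_comm]
  refine Finset.sum_congr rfl fun x _ => ?_
  simp only [ite_and, ite_mul, zero_mul]
  rw [Finset.sum_comm]
  simp only [Finset.sum_ite_eq, Finset.mem_univ, if_true]

theorem sum_sign_update (x : Config N) (i : ZMod N) (a : Fin 2) :
    ∑ j, sign j (Function.update x i a) =
      ∑ j, sign j x - sign i x + if a = 1 then 1 else -1 := by
  rw [← Finset.add_sum_erase _ _ (Finset.mem_univ i),
    ← Finset.add_sum_erase _ (fun j => sign j x) (Finset.mem_univ i)]
  have : ∑ j ∈ Finset.univ.erase i, sign j (Function.update x i a) =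
      ∑ j ∈ Finset.univ.erase i, sign j x := by
    refine Finset.sum_congr rfl fun j hj => ?_
    simp [sign, (Finset.mem_erase.1 hj).1]
  rw [this]
  simp only [sign, Function.update_self]
  ring

/-- A uniformly chosen player loses his old sign and receives a new one whose conditional mean is
his drift. -/
theorem gameB_mulVec_sum_sign (p : Fin 4 → ℝ) (x : Config N) :
    (gameB N p *ᵥ fun x => ∑ i, sign i x) x =
      ∑ i, sign i x + meanDrift p x - (N : ℝ)⁻¹ * ∑ i, sign i x := by
  have hN : (N : ℝ) ≠ 0 := Nat.cast_ne_zero.2 (NeZero.ne N)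
  rw [gameB_mulVec]
  simp only [sum_sign_update, if_true, if_neg (zero_ne_one : (0 : Fin 2) ≠ 1)]
  have h1 : ∀ i : ZMod N, p (nbrIndex x i) * (∑ j, sign j x - sign i x + 1) +
      (1 - p (nbrIndex x i)) * (∑ j, sign j x - sign i x + -1) =
      ∑ j, sign j x + drift p i x - sign i x := fun i => by
    simp only [drift]
    ring
  simp only [h1, Finset.sum_sub_distrib, Finset.sum_add_distrib, Finset.sum_const, meanDrift,
    Finset.card_univ, ZMod.card, nsmul_eq_mul]
  field_simp

/-- Evolution of the mean sign of a player under one play of game `B`. -/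
theorem ShiftInvariant.vecMul_gameB_dotProduct_sign {ν : Config N → ℝ} (hν : ShiftInvariant ν)
    (p : Fin 4 → ℝ) :
    N * ((ν ᵥ* gameB N p) ⬝ᵥ sign 1) =
      N * (ν ⬝ᵥ sign 1) + ν ⬝ᵥ meanDrift p - ν ⬝ᵥ sign 1 := by
  have hN : (N : ℝ) ≠ 0 := Nat.cast_ne_zero.2 (NeZero.ne N)
  have hs : ∀ (c i : ZMod N) (x : Config N), sign i (shift c x) = sign (i + c) x :=
    fun c i x => rfl
  rw [← (hν.vecMul (commutesWithShift_gameB p)).dotProduct_sum hs 1, ← dotProduct_mulVec]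
  have h1 : (gameB N p *ᵥ fun x => ∑ i, sign i x) = (fun x => ∑ i, sign i x) + meanDrift p -
      (N : ℝ)⁻¹ • fun x => ∑ i, sign i x := by
    ext x
    exact gameB_mulVec_sum_sign p x
  rw [h1, dotProduct_sub, dotProduct_add, dotProduct_smul, hν.dotProduct_sum hs 1, smul_eq_mul]
  field_simp

theorem ShiftInvariant.vecMul_gameA_dotProduct_sign {ν : Config N → ℝ} (hν : ShiftInvariant ν) :
    N * ((ν ᵥ* gameA N) ⬝ᵥ sign 1) = N * (ν ⬝ᵥ sign 1) - ν ⬝ᵥ sign 1 := by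
  rw [gameA, hν.vecMul_gameB_dotProduct_sign, meanDrift_half, dotProduct_zero, add_zero]

theorem ShiftInvariant.vecMul_gameA_pow_dotProduct_sign {ν : Config N → ℝ}
    (hν : ShiftInvariant ν) (u : ℕ) :
    (ν ᵥ* gameA N ^ u) ⬝ᵥ sign 1 = (1 - 1 / (N : ℝ)) ^ u * (ν ⬝ᵥ sign 1) := by
  have hN : (N : ℝ) ≠ 0 := Nat.cast_ne_zero.2 (NeZero.ne N)
  induction u with
  | zero => simp
  | succ u ih =>
    have h := (hν.vecMul (commutesWithShift_gameA.pow u)).vecMul_gameA_dotProduct_sign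
    rw [Matrix.vecMul_vecMul, ← pow_succ, ih] at h
    rw [pow_succ (1 - 1 / (N : ℝ))]
    field_simp at h ⊢
    linarith

/-- Over a period in equilibrium, the total mean payoff equals the total mean sign. -/
theorem IsStationaryDistribution.sum_meanDrift_eq {p : Fin 4 → ℝ} {r s : ℕ} {π : Config N → ℝ}
    (hπ : IsStationaryDistribution (gameA N ^ r * gameB N p ^ s) π) (hi : ShiftInvariant π) :
    ∑ v ∈ Finset.range s, (π ᵥ* (gameA N ^ r * gameB N p ^ v)) ⬝ᵥ meanDrift p =
      ∑ u ∈ Finset.range r, (π ᵥ* gameA N ^ u) ⬝ᵥ sign 1 +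
        ∑ v ∈ Finset.range s, (π ᵥ* (gameA N ^ r * gameB N p ^ v)) ⬝ᵥ sign 1 := by
  have hA : ∀ u, (N : ℝ) * ((π ᵥ* gameA N ^ (u + 1)) ⬝ᵥ sign 1) -
      N * ((π ᵥ* gameA N ^ u) ⬝ᵥ sign 1) = - ((π ᵥ* gameA N ^ u) ⬝ᵥ sign 1) := by
    intro u
    have h := (hi.vecMul (commutesWithShift_gameA.pow u)).vecMul_gameA_dotProduct_sign
    rw [Matrix.vecMul_vecMul, ← pow_succ] at h
    linarith
  have hB : ∀ v, (N : ℝ) * ((π ᵥ* (gameA N ^ r * gameB N p ^ (v + 1))) ⬝ᵥ sign 1) -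
      N * ((π ᵥ* (gameA N ^ r * gameB N p ^ v)) ⬝ᵥ sign 1) =
      (π ᵥ* (gameA N ^ r * gameB N p ^ v)) ⬝ᵥ meanDrift p -
        (π ᵥ* (gameA N ^ r * gameB N p ^ v)) ⬝ᵥ sign 1 := by
    intro v
    have h := (hi.vecMul (commutesWithShift_pattern p r v)).vecMul_gameB_dotProduct_sign p
    rw [Matrix.vecMul_vecMul, mul_assoc, ← pow_succ] at h
    linarith
  -- The two telescoping sums join at `π P_A^r`, and their outer ends agree by stationarity.
  have hA' := Finset.sum_range_sub (fun u => (N : ℝ) * ((π ᵥ* gameA N ^ u) ⬝ᵥ sign 1)) r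
  have hB' := Finset.sum_range_sub
    (fun v => (N : ℝ) * ((π ᵥ* (gameA N ^ r * gameB N p ^ v)) ⬝ᵥ sign 1)) s
  simp only [hA, hB, hπ.2, pow_zero, mul_one, Matrix.vecMul_one, Finset.sum_neg_distrib,
    Finset.sum_sub_distrib] at hA' hB'
  linarith

end Marginals

/-! ### Poisson equation for the periodic augmented chain -/

section Poisson

variable {N : ℕ}

/-- The lift to the augmented state space of a solution of the Poisson equation. -/
def liftAug (p : Fin 4 → ℝ) (μ : ℝ) (φ : Config N → ℝ) (a : AugState N) : ℝ :=
  drift p a.2 a.1 - μ + (p (nbrIndex a.1 a.2) * φ (Function.update a.1 a.2 1) +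
    (1 - p (nbrIndex a.1 a.2)) * φ (Function.update a.1 a.2 0))

theorem abs_liftAug_le {p : Fin 4 → ℝ} (hp : ∀ m, p m ∈ Set.Icc (0 : ℝ) 1) (μ : ℝ)
    {φ : Config N → ℝ} {C : ℝ} (hφ : ∀ x, |φ x| ≤ C) (a : AugState N) :
    |liftAug p μ φ a| ≤ 1 + |μ| + C := by
  obtain ⟨h0, h1⟩ := hp (nbrIndex a.1 a.2)
  simp only [liftAug, drift]
  generalize p (nbrIndex a.1 a.2) = t at *
  have e1 := abs_le.1 (hφ (Function.update a.1 a.2 1))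
  have e0 := abs_le.1 (hφ (Function.update a.1 a.2 0))
  have eμ := abs_le.1 (le_refl |μ|)
  have f1 := mul_le_mul_of_nonneg_left e1.1 h0
  have f2 := mul_le_mul_of_nonneg_left e1.2 h0
  have f3 := mul_le_mul_of_nonneg_left e0.1 (sub_nonneg.2 h1)
  have f4 := mul_le_mul_of_nonneg_left e0.2 (sub_nonneg.2 h1)
  rw [abs_le]
  constructor <;> linarith

variable [NeZero N]

/-- The parameters of the game played at time `n` of the pattern `A^r B^s`. -/
noncomputable def patternParam (p : Fin 4 → ℝ) (r s n : ℕ) : Fin 4 → ℝ :=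
  if n % (r + s) < r then fun _ => 1 / 2 else p

theorem patternParam_mem_Icc {p : Fin 4 → ℝ} (hp : ∀ m, p m ∈ Set.Icc (0 : ℝ) 1) (r s n : ℕ)
    (m : Fin 4) : patternParam p r s n m ∈ Set.Icc (0 : ℝ) 1 := by
  unfold patternParam
  split_ifs
  · exact half_mem_Icc m
  · exact hp m

theorem patternStar_eq (p : Fin 4 → ℝ) (r s n : ℕ) :
    patternStar N p r s n = gameBStar N (patternParam p r s n) := by
  unfold patternStar patternParam
  split_ifs <;> rfl

/-- Backward recursion for the total mean payoff in excess of `μ`, with final reward `φ`, where the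
last `s` games are `B` and all earlier ones are `A`. -/
noncomputable def backward (p : Fin 4 → ℝ) (s : ℕ) (μ : ℝ) (φ : Config N → ℝ) :
    ℕ → Config N → ℝ
  | 0 => φ
  | j + 1 => if j < s then meanDrift p - μ • 1 + gameB N p *ᵥ backward p s μ φ j
      else -(μ • 1) + gameA N *ᵥ backward p s μ φ j

theorem backward_of_le {p : Fin 4 → ℝ} (hp : ∀ m, p m ∈ Set.Icc (0 : ℝ) 1) {s : ℕ} (μ : ℝ)
    (φ : Config N → ℝ) {j : ℕ} (hj : j ≤ s) :
    backward p s μ φ j = ∑ v ∈ Finset.range j, gameB N p ^ v *ᵥ meanDrift p - (j * μ) • 1 +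
      gameB N p ^ j *ᵥ φ := by
  induction j with
  | zero => simp [backward]
  | succ j ih =>
    rw [backward, if_pos (by omega), ih (by omega), Matrix.mulVec_add, Matrix.mulVec_sub,
      Matrix.mulVec_smul, (mem_rowStochastic.1 (gameB_mem_rowStochastic hp)).2, Matrix.mulVec_sum,
      Finset.sum_range_succ']
    simp only [Matrix.mulVec_mulVec, ← pow_succ', pow_zero, Matrix.one_mulVec]
    push_cast
    module

/-- For `k = r` the right side is that of the one-period Poisson equation, so a solution `φ` makes
the recursion periodic. -/
theorem backward_add {p : Fin 4 → ℝ} (hp : ∀ m, p m ∈ Set.Icc (0 : ℝ) 1) (s : ℕ) (μ : ℝ)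
    (φ : Config N → ℝ) (k : ℕ) :
    backward p s μ φ (s + k) = ∑ v ∈ Finset.range s, (gameA N ^ k * gameB N p ^ v) *ᵥ meanDrift p -
      ((k + s) * μ) • 1 + (gameA N ^ k * gameB N p ^ s) *ᵥ φ := by
  induction k with
  | zero => simp [backward_of_le hp μ φ le_rfl]
  | succ k ih =>
    rw [← add_assoc, backward, if_neg (by omega), ih, Matrix.mulVec_add, Matrix.mulVec_sub,
      Matrix.mulVec_smul, (mem_rowStochastic.1 gameA_mem_rowStochastic).2, Matrix.mulVec_sum]
    simp only [Matrix.mulVec_mulVec, ← pow_succ', ← mul_assoc]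
    push_cast
    module

/-- The Poisson equation for the periodic chain of configurations. -/
theorem IsStationaryDistribution.exists_periodic_poisson {p : Fin 4 → ℝ}
    (hp : ∀ m, p m ∈ Set.Icc (0 : ℝ) 1) {r s : ℕ} (hr : 1 ≤ r) {π : Config N → ℝ}
    (hπ : IsStationaryDistribution (gameA N ^ r * gameB N p ^ s) π) {μ : ℝ}
    (hμ : ∑ v ∈ Finset.range s, (π ᵥ* (gameA N ^ r * gameB N p ^ v)) ⬝ᵥ meanDrift p =
      (r + s) * μ) :
    ∃ (Φ : ℕ → Config N → ℝ) (C : ℝ), (∀ n x, |Φ n x| ≤ C) ∧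
      ∀ n, Φ n = meanDrift (patternParam p r s n) - μ • 1 +
        gameB N (patternParam p r s n) *ᵥ Φ (n + 1) := by
  have hπ1 : π ⬝ᵥ (1 : Config N → ℝ) = 1 := by simpa [dotProduct] using hπ.1.2
  obtain ⟨φ, hφ⟩ := hπ.exists_poisson (fun h hh => eq_of_pattern_mulVec_eq hp hr s hh)
    (H := ∑ v ∈ Finset.range s, (gameA N ^ r * gameB N p ^ v) *ᵥ meanDrift p -
      ((r + s) * μ) • 1) (by
    rw [dotProduct_sub, dotProduct_sum, dotProduct_smul, hπ1]
    simp only [dotProduct_mulVec, hμ]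
    simp)
  set V := backward p s μ φ with hV
  have hVT : V (r + s) = V 0 := by
    rw [add_comm, hV, backward_add hp, ← hφ]
    rfl
  -- The index of `V` is the number of games left in the current period, from `1` to `r + s`.
  refine ⟨fun n => V (r + s - n % (r + s)),
    ∑ j ∈ Finset.range (r + s + 1), ∑ x, |V j x|, fun n x => ?_, fun n => ?_⟩
  · refine (Finset.single_le_sum (f := fun y => |V (r + s - n % (r + s)) y|)
      (fun y _ => abs_nonneg _) (Finset.mem_univ x)).trans ?_
    exact Finset.single_le_sum (f := fun j => ∑ y, |V j y|)
      (fun j _ => Finset.sum_nonneg fun y _ => abs_nonneg _) (Finset.mem_range.2 (by omega))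
  · have hm : n % (r + s) < r + s := Nat.mod_lt _ (by omega)
    have hnext : V (r + s - (n + 1) % (r + s)) = V (r + s - n % (r + s) - 1) := by
      rw [← Nat.mod_add_mod]
      -- At the end of a period the index jumps from `0` to `r + s`, where `V` takes the same value.
      rcases (Nat.succ_le_of_lt hm).lt_or_eq with h | h
      · rw [Nat.mod_eq_of_lt h]
        congr 1
      · rw [show n % (r + s) + 1 = r + s from h, Nat.mod_self, Nat.sub_zero, hVT]
        congr 1
        omega
    show V (r + s - n % (r + s)) = _ + _ *ᵥ V (r + s - (n + 1) % (r + s))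
    rw [hnext]
    unfold patternParam
    generalize n % (r + s) = m at *
    obtain ⟨j, hj⟩ : ∃ j, r + s - m = j + 1 := ⟨r + s - m - 1, by omega⟩
    rw [hj, Nat.add_sub_cancel, hV, backward]
    by_cases h : m < r
    · rw [if_pos h, if_neg (by omega), meanDrift_half, zero_sub, gameA]
    · rw [if_neg h, if_pos (by omega)]

theorem sum_liftAug (p : Fin 4 → ℝ) (μ : ℝ) (φ : Config N → ℝ) (x : Config N) :
    (N : ℝ)⁻¹ * ∑ j : ZMod N, liftAug p μ φ (x, j) =
      (meanDrift p - μ • 1 + gameB N p *ᵥ φ : Config N → ℝ) x := by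
  have hN : (N : ℝ) ≠ 0 := Nat.cast_ne_zero.2 (NeZero.ne N)
  simp only [liftAug, Pi.add_apply, Pi.sub_apply, Pi.smul_apply, Pi.one_apply, gameB_mulVec,
    meanDrift, Finset.sum_add_distrib, Finset.sum_sub_distrib, Finset.sum_const, Finset.card_univ,
    ZMod.card, nsmul_eq_mul, smul_eq_mul]
  field_simp

/-- `liftAug` is the conditional mean of payoff - `μ` + `φ` after the play. The next player is
uniform and independent of the outcome, so only the average of `g` over players enters. -/
theorem gameBStar_mulVec_payoff_add (p : Fin 4 → ℝ) (μ : ℝ) (φ : Config N → ℝ)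
    {g : AugState N → ℝ} (hg : ∀ x, (N : ℝ)⁻¹ * ∑ j : ZMod N, g (x, j) = φ x) (a : AugState N) :
    ∑ b, gameBStar N p a b * (payoff a b - μ - liftAug p μ φ a + g b) = 0 := by
  obtain ⟨x, i⟩ := a
  have hN : (N : ℝ) ≠ 0 := Nat.cast_ne_zero.2 (NeZero.ne N)
  have h := gameBStar_mulVec p
    (fun b => payoff (x, i) b - μ - liftAug p μ φ (x, i) + g b) x i
  refine h.trans ?_
  simp only [payoff_update_one, payoff_update_zero, mul_add, Finset.sum_add_distrib,
    ← Finset.mul_sum, Finset.sum_const, Finset.card_univ, ZMod.card, nsmul_eq_mul]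
  have h1 := hg (Function.update x i 1)
  have h0 := hg (Function.update x i 0)
  simp only [liftAug, drift, ← h1, ← h0]
  field_simp
  ring

theorem abs_payoff_le (a b : AugState N) : |payoff a b| ≤ 1 := by
  unfold payoff
  split_ifs <;> simp

/-- The strong law of large numbers for the accumulated profit. -/
theorem IsStationaryDistribution.ae_tendsto_profit {p : Fin 4 → ℝ}
    (hp : ∀ m, p m ∈ Set.Icc (0 : ℝ) 1) {r s : ℕ} (hr : 1 ≤ r) {π : Config N → ℝ}
    (hπ : IsStationaryDistribution (gameA N ^ r * gameB N p ^ s) π) {μ : ℝ}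
    (hμ : ∑ v ∈ Finset.range s, (π ᵥ* (gameA N ^ r * gameB N p ^ v)) ⬝ᵥ meanDrift p =
      (r + s) * μ) {Ω : Type*} [MeasurableSpace Ω] {ℙ : Measure Ω} [IsProbabilityMeasure ℙ]
    {X : ℕ → Ω → AugState N} (hX : IsMarkovChain (patternStar N p r s) ℙ X) :
    ∀ᵐ ω ∂ℙ, Tendsto (fun n : ℕ => (n : ℝ)⁻¹ * profit X n ω) atTop (𝓝 μ) := by
  obtain ⟨Φ, C, hC, hΦ⟩ := hπ.exists_periodic_poisson hp hr hμ
  refine hX.ae_tendsto_of_poisson (w := payoff)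
    (g := fun n => liftAug (patternParam p r s n) μ (Φ (n + 1))) abs_payoff_le
    (fun n => abs_liftAug_le (patternParam_mem_Icc hp r s n) μ (hC (n + 1))) fun n a => ?_
  rw [patternStar_eq]
  refine gameBStar_mulVec_payoff_add _ μ (Φ (n + 1)) (fun x => ?_) a
  rw [sum_liftAug, ← hΦ]

end Poisson

end Parrondo

/-! ### The main theorem -/

theorem mainTheorem2 (N : ℕ) [NeZero N] (hN : 3 ≤ N) (p : Fin 4 → ℝ)
    (hp : ∀ m, p m ∈ Set.Icc (0 : ℝ) 1) (r s : ℕ) (hr : 1 ≤ r) (hs : 1 ≤ s) :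
    (∃! π : Parrondo.Config N → ℝ, Parrondo.IsStationaryDistribution
      (Parrondo.gameA N ^ r * Parrondo.gameB N p ^ s) π) ∧
    ∀ π : Parrondo.Config N → ℝ,
      Parrondo.IsStationaryDistribution (Parrondo.gameA N ^ r * Parrondo.gameB N p ^ s) π →
      ∃ μ : ℝ,
        -- strong law of large numbers, for every initial distribution
        (∀ (Ω : Type*) [MeasurableSpace Ω] (ℙ : Measure Ω) [IsProbabilityMeasure ℙ]
          (X : ℕ → Ω → Parrondo.AugState N),
          Parrondo.IsMarkovChain (Parrondo.patternStar N p r s) ℙ X →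
          ∀ᵐ ω ∂ℙ, Tendsto (fun n : ℕ => (n : ℝ)⁻¹ * Parrondo.profit X n ω) atTop (𝓝 μ)) ∧
        -- formula in terms of the full law
        μ = 1 / ((r : ℝ) + s) * ∑ v ∈ Finset.range s, ∑ x : Parrondo.Config N,
          (π ᵥ* (Parrondo.gameA N ^ r * Parrondo.gameB N p ^ v)) x *
            ((1 / (N : ℝ)) * ∑ i : ZMod N,
              (p (Parrondo.nbrIndex x i) - (1 - p (Parrondo.nbrIndex x i)))) ∧
        -- formula in terms of the `1,3` two-dimensional marginals
        μ = 1 / ((r : ℝ) + s) * ∑ v ∈ Finset.range s, ∑ w : Fin 2, ∑ z : Fin 2,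
          Parrondo.marginal₂ (π ᵥ* (Parrondo.gameA N ^ r * Parrondo.gameB N p ^ v)) 1 3 w z *
            (p (Parrondo.pairIndex w z) - (1 - p (Parrondo.pairIndex w z))) ∧
        -- formula in terms of the one-dimensional marginals
        μ = 1 / ((r : ℝ) + s) *
          (∑ u ∈ Finset.range r,
              (Parrondo.marginal₁ (π ᵥ* Parrondo.gameA N ^ u) 1 1 -
                Parrondo.marginal₁ (π ᵥ* Parrondo.gameA N ^ u) 1 0) +
            ∑ v ∈ Finset.range s,
              (Parrondo.marginal₁ (π ᵥ* (Parrondo.gameA N ^ r * Parrondo.gameB N p ^ v)) 1 1 -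
                Parrondo.marginal₁ (π ᵥ* (Parrondo.gameA N ^ r * Parrondo.gameB N p ^ v)) 1 0)) ∧
        -- closed form for `s = 1`
        (s = 1 →
          μ = (N : ℝ) * (1 - (1 - 1 / (N : ℝ)) ^ (r + 1)) /
              (((r : ℝ) + 1) * (1 - 1 / (N : ℝ)) ^ r) *
            (Parrondo.marginal₁ (π ᵥ* Parrondo.gameA N ^ r) 1 1 -
              Parrondo.marginal₁ (π ᵥ* Parrondo.gameA N ^ r) 1 0)) := by
  have hu := Parrondo.existsUnique_isStationaryDistribution (N := N) hp hr s
  refine ⟨hu, fun π hπ => ?_⟩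
  have hi := hπ.shiftInvariant (Parrondo.commutesWithShift_pattern p r s) hu
  have hN0 : (N : ℝ) ≠ 0 := Nat.cast_ne_zero.2 (NeZero.ne N)
  have hrs : (r : ℝ) + s ≠ 0 := by positivity
  have hsum := hπ.sum_meanDrift_eq hi
  simp only [Parrondo.marginal₁_sub, Parrondo.sum_marginal₂_mul]
  refine ⟨1 / ((r : ℝ) + s) * ∑ v ∈ Finset.range s,
    (π ᵥ* (Parrondo.gameA N ^ r * Parrondo.gameB N p ^ v)) ⬝ᵥ Parrondo.meanDrift p,
    fun Ω _ ℙ _ X hX => hπ.ae_tendsto_profit hp hr (by field_simp) hX, rfl, ?_, ?_, ?_⟩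
  · congr 1
    refine Finset.sum_congr rfl fun v _ => ?_
    exact (hi.vecMul (Parrondo.commutesWithShift_pattern p r v)).dotProduct_meanDrift p 2
  · rw [hsum]
  · rintro rfl
    rw [hsum]
    simp only [Finset.sum_range_one, pow_zero, mul_one,
      hi.vecMul_gameA_pow_dotProduct_sign, ← Finset.sum_mul]
    have hq : 1 - 1 / (N : ℝ) ≠ 1 := by
      intro h
      have : 1 / (N : ℝ) = 0 := by linarith
      simp [hN0] at this
    -- The closed form expresses the mean sign under `π` through that under `π P_A^r`, which
    -- requires dividing by `(1 - 1/N)^r`.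
    have hq0 : 1 - 1 / (N : ℝ) ≠ 0 := by
      have h3 : (3 : ℝ) ≤ N := by exact_mod_cast hN
      have : 1 / (N : ℝ) < 1 := by
        rw [div_lt_one (by linarith)]
        linarith
      linarith
    -- For `s = 1` the single `B` term supplies the power `r`, completing a geometric sum of `r + 1`
    -- terms.
    rw [← add_mul, ← Finset.sum_range_succ, geom_sum_eq hq]
    have hr1 : (r : ℝ) + 1 ≠ 0 := by positivity
    have hd : 1 - 1 / (N : ℝ) - 1 = -(1 / N) := by ring
    rw [hd]
    generalize 1 - 1 / (N : ℝ) = q at *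
    push_cast
    field_simp
    ring
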